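/- There are $n$ items, of which $k$ are defective; the defective set $\mathcal K\subseteq\{1,\dots,n\}$ is uniformly random among the sets of size $k$. In Bernoulli nonadaptive group testing with parameter $p\in[0,1]$ and $T$ tests, each item $i$ is placed in each test $t$ independently with probability $p$ (write $x_{ti}=1$ if $i$ is in test $t$, and $x_{ti}=0$ otherwise), and the outcome is $y_t=1$ if test $t$ contains an item of $\mathcal K$, and $y_t=0$ otherwise. A (possibly randomised) detection algorithm produces from $(x,y)$, and possibly $n$ and $k$, an estimate $\hat{\mathcal K}$ of $\mathcal K$ or declares a failure; its average error probability is $\binom nk^{-1}\sum_{|\mathcal K|=k}\mathbb P(\hat{\mathcal K}\ne\mathcal K)$. Let $\theta\in(0,1)$ and let $k=k(n)=\Theta(n^\theta)$. A rate $R$ is achievable by a detection algorithm $\mathtt A$ if for every $\varepsilon>0$ and all sufficiently large $n$ there are $p=p(n)\in[0,1]$ and $T=T(n)\ge 1$ with $\log_2\binom nk/T>R$ for which $\mathtt A$ has average error probability less than $\varepsilon$. Write $R^*_{\mathtt A}$ for the supremum of the rates achievable by $\mathtt A$. The DD algorithm calls an item a possible defective if it is in no negative test, and outputs the set of those possible defectives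 that are the only possible defective in some test. A linear-programming (LP) approach finds, whenever one exists (as it always does for outcomes produced by an actual defective set), an optimal solution $z$ of: minimize $\sum_i z_i$ over real $z_i\ge 0$ subject to $\sum_i x_{ti}z_i\ge 1$ when $y_t=1$ and $\sum_i x_{ti}z_i=0$ when $y_t=0$ (ties broken in any way), and turns $z$ into an estimate by any (possibly randomised) heuristic that outputs $\{i: z_i=1\}$ whenever all $z_i\in\{0,1\}$. Theorem. For every LP approach, $$R^*_{\mathrm{LP}}\ \ge\ R^*_{\mathrm{DD}}\ \ge\ \min\left\{\frac1{\mathrm e\ln 2},\ \frac1{\mathrm e\ln 2}\,\frac{1-\theta}{\theta}\right\}.$$ Moreover, for $\theta\ge 1/2$ every LP approach is optimal: $R^*_{\mathrm{LP}}$ equals the capacity of Bernoulli nonadaptive group testing, that is, the supremum of $R^*_{\mathtt A}$ over all detection algorithms $\mathtt A$, and this equals $$\max_{\nu>0}\min\left\{h(\mathrm e^{-\nu}),\ \frac{\nu}{\mathrm e^{\nu}\ln 2}\,\frac{1-\theta}{\theta}\right\},$$ where $h$ is the binary entropy in bits. -/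

import Mathlib

open Filter Topology Asymptotics

noncomputable section

namespace GroupTesting

/-- A test design for `n` items and `T` tests: `x t i = true` iff item `i` is in test `t`. -/
abbrev Design (n T : ℕ) : Type := Fin T → Fin n → Bool

/-- The outcomes of `T` tests: `y t = true` iff test `t` is positive. -/
abbrev Outcomes (T : ℕ) : Type := Fin T → Bool

/-- The outcomes of the tests of the design `x` when the defective set is `K`: a test is positive
iff it contains an item of `K`. -/
def outcomes {n T : ℕ} (K : Finset (Fin n)) (x : Design n T) : Outcomes T :=
  fun t => decide (∃ i ∈ K, x t i = true)

/-- The probability of the design `x` under Bernoulli testing with parameter `p`: each item is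
placed in each test independently with probability `p`. -/
def designProb {n T : ℕ} (p : ℝ) (x : Design n T) : ℝ :=
  ∏ t, ∏ i, if x t i = true then p else 1 - p

/-- A (possibly randomised) detection algorithm. From the number `n` of items, the number `k` of
defectives (which the algorithm may ignore), the design and the outcomes, it produces the law of
its estimate; the value `none` means that the algorithm declares a failure. -/
abbrev Decoder : Type :=
  ∀ n _k T : ℕ, Design n T → Outcomes T → PMF (Option (Finset (Fin n)))

/-- The average error probability of the decoder `A` with `T` Bernoulli(`p`) tests: the average
over all defective sets `K` of size `k` of the probability, over the design and the internal
randomness of the decoder, that the estimate differs from `K`. -/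
def errorProb (A : Decoder) (p : ℝ) (n k T : ℕ) : ℝ :=
  (1 / (n.choose k : ℝ)) *
    ∑ K ∈ Finset.powersetCard k (Finset.univ : Finset (Fin n)),
      ∑ x : Design n T, designProb p x * (1 - (A n k T x (outcomes K x) (some K)).toReal)

/-- The rate `R` is achievable by the decoder `A` with Bernoulli tests, when there are `k n`
defectives among `n` items. -/
def Achievable (A : Decoder) (k : ℕ → ℕ) (R : ℝ) : Prop :=
  ∀ ε : ℝ, 0 < ε → ∀ᶠ n : ℕ in atTop, ∃ p ∈ Set.Icc (0 : ℝ) 1, ∃ T : ℕ, 0 < T ∧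
    R < Real.logb 2 (n.choose (k n) : ℝ) / (T : ℝ) ∧ errorProb A p n (k n) T < ε

/-- The maximum achievable rate `R*` of the decoder `A` with Bernoulli tests (the supremum of its
achievable rates, taken in the extended reals). -/
def maxRate (A : Decoder) (k : ℕ → ℕ) : EReal :=
  sSup {r : EReal | ∃ R : ℝ, Achievable A k R ∧ r = (R : EReal)}

/-- The capacity of Bernoulli testing: the maximum achievable rate over all decoders. -/
def capacity (k : ℕ → ℕ) : EReal := ⨆ B : Decoder, maxRate B k

/-- The closed-form expression
`max_{ν > 0} min {h(e^{-ν}), ν / (e^ν ln 2) * (1 - θ) / θ}`, with `h` the binary entropy in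
bits. -/
def capacityFormula (θ : ℝ) : ℝ :=
  sSup ((fun ν : ℝ => min (Real.binEntropy (Real.exp (-ν)) / Real.log 2)
    (ν / (Real.exp ν * Real.log 2) * ((1 - θ) / θ))) '' Set.Ioi 0)

/-- The possible defectives: the items that are in no negative test. -/
def possibleDefectives {n T : ℕ} (x : Design n T) (y : Outcomes T) : Finset (Fin n) :=
  Finset.univ.filter fun i => ∀ t, x t i = true → y t = true

/-- The definite defectives: the items that are the only possible defective of some test. -/
def definiteDefectives {n T : ℕ} (x : Design n T) (y : Outcomes T) : Finset (Fin n) :=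
  Finset.univ.filter fun i => i ∈ possibleDefectives x y ∧
    ∃ t, x t i = true ∧ ∀ j ∈ possibleDefectives x y, x t j = true → j = i

/-- The DD algorithm: it declares exactly the definite defectives to be defective. -/
def ddDecoder : Decoder := fun _ _ _ x y => PMF.pure (some (definiteDefectives x y))

/-- Feasible points of the linear-programming relaxation. -/
def LPFeasible {n T : ℕ} (x : Design n T) (y : Outcomes T) (z : Fin n → ℝ) : Prop :=
  (∀ i, 0 ≤ z i) ∧
    (∀ t, y t = true → 1 ≤ ∑ i, (if x t i = true then (1 : ℝ) else 0) * z i) ∧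
    (∀ t, y t = false → ∑ i, (if x t i = true then (1 : ℝ) else 0) * z i = 0)

/-- Optimal solutions of the linear-programming relaxation: minimisers of `∑ i, z i` among the
feasible points. -/
def LPOptimal {n T : ℕ} (x : Design n T) (y : Outcomes T) (z : Fin n → ℝ) : Prop :=
  LPFeasible x y z ∧ ∀ w : Fin n → ℝ, LPFeasible x y w → ∑ i, z i ≤ ∑ i, w i

/-- `A` is a linear-programming approach: whenever the relaxed program is feasible (as it always
is for outcomes produced by an actual defective set), `A` finds an optimal solution `z` (ties may
be broken in any way, even at random) and applies to it some (possibly randomised) heuristic, which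
returns `{i | z i = 1}` in the event that all entries of `z` are `0` or `1`. -/
def IsLPDecoder (A : Decoder) : Prop :=
  ∀ (n k T : ℕ) (x : Design n T) (y : Outcomes T), (∃ w, LPFeasible x y w) →
    ∃ (solver : PMF (Fin n → ℝ)) (heuristic : (Fin n → ℝ) → PMF (Option (Finset (Fin n)))),
      (∀ z ∈ solver.support, LPOptimal x y z) ∧
      (∀ z, LPOptimal x y z → (∀ i, z i = 0 ∨ z i = 1) →
        heuristic z = PMF.pure (some (Finset.univ.filter fun i => z i = 1))) ∧
      A n k T x y = solver.bind heuristic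

end GroupTesting

end

namespace GroupTesting

/-! Every threshold comes from one event: a test isolates item `i` from `K` if it contains `i` and
no other item of `K`. At `p = 1/k` this has probability about `1/(ek)`, and no `p` does essentially
better.

LP beats DD design by design. If DD recovers `K`, each `i ∈ K` is the only possible defective of
some test, which forces `z i ≥ 1` for every feasible `z`. The indicator of `K` is feasible, so it is
the unique optimum (`lpOptimal_eq_indicator`).

For DD, take `p = 1/k` and `T ≈ τ k ln n`. The expected number of false positives is about `n
e^{-T/(ek)}`, which is `o(k)` if `τ/e > 1 - θ`; Markov's inequality then leaves at most `ηk` of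
them. The entries of nondefectives in positive tests are independent of the outcomes and of the
false positives (`sum_designProb_resample`). So each test isolating `i ∈ K` is spoiled with
probability at most `η`, and a union bound over `K` succeeds if `τ/e > θ` (with `η` small). The rate
is about `(1 - θ)/(τ ln 2)`, whence the minimum of two terms.

Conversely, a defective item isolated by no test can be deleted without changing the outcomes. Sets
with such an item therefore share at most `n.choose (k - 1)` outcomes, a vanishing fraction of
`n.choose k`, and any decoder is right at most once per outcome. Chebyshev's inequality shows that a
masked item exists with high probability when `T` is below `e θ k ln n` by a constant factor
(`le_errorProb`, `not_achievable`). For `θ ≥ 1/2` this meets the DD bound, and the formula is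
maximised at `ν = 1`. -/

/-! ### Product formulas for Bernoulli designs -/

/-- The probability of a single test (a row of the design). -/
noncomputable def rowProb {n : ℕ} (p : ℝ) (r : Fin n → Bool) : ℝ :=
  ∏ i, if r i = true then p else 1 - p

lemma designProb_eq_prod {n T : ℕ} (p : ℝ) (x : Design n T) :
    designProb p x = ∏ t, rowProb p (x t) := rfl

lemma rowProb_nonneg {n : ℕ} {p : ℝ} (hp : p ∈ Set.Icc (0 : ℝ) 1) (r : Fin n → Bool) :
    0 ≤ rowProb p r := by
  refine Finset.prod_nonneg fun i _ => ?_
  split_ifs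
  · exact hp.1
  · linarith [hp.2]

lemma designProb_nonneg {n T : ℕ} {p : ℝ} (hp : p ∈ Set.Icc (0 : ℝ) 1) (x : Design n T) :
    0 ≤ designProb p x :=
  Finset.prod_nonneg fun t _ => rowProb_nonneg hp (x t)

lemma sum_rowProb_mul_prod {n : ℕ} (p : ℝ) (h : Fin n → Bool → ℝ) :
    ∑ r : Fin n → Bool, rowProb p r * ∏ i, h i (r i) =
      ∏ i, (p * h i true + (1 - p) * h i false) := by
  have := Finset.prod_univ_sum (fun _ : Fin n => (Finset.univ : Finset Bool))
    (fun i v => (if v = true then p else 1 - p) * h i v)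
  simp only [Fintype.sum_bool, Fintype.piFinset_univ] at this
  simp only [rowProb, ← Finset.prod_mul_distrib]
  rw [← this]
  simp

lemma sum_designProb_mul_prod {n T : ℕ} (p : ℝ) (g : Fin T → (Fin n → Bool) → ℝ) :
    ∑ x : Design n T, designProb p x * ∏ t, g t (x t) =
      ∏ t, ∑ r : Fin n → Bool, rowProb p r * g t r := by
  have := Finset.prod_univ_sum (fun _ : Fin T => (Finset.univ : Finset (Fin n → Bool)))
    (fun t r => rowProb p r * g t r)
  simp only [Fintype.piFinset_univ] at this
  rw [this]
  simp only [designProb_eq_prod, ← Finset.prod_mul_distrib]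

lemma sum_rowProb {n : ℕ} (p : ℝ) : ∑ r : Fin n → Bool, rowProb p r = 1 := by
  simpa using sum_rowProb_mul_prod (n := n) p (fun _ _ => 1)

lemma sum_designProb {n T : ℕ} (p : ℝ) : ∑ x : Design n T, designProb p x = 1 := by
  simpa [sum_rowProb] using sum_designProb_mul_prod (n := n) (T := T) p (fun _ _ => 1)

/-- The probability that a test contains all items of `A` and no item of `B`. -/
lemma sum_rowProb_ite {n : ℕ} (p : ℝ) {A B : Finset (Fin n)} (hAB : Disjoint A B) :
    ∑ r : Fin n → Bool, rowProb p r *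
        (if (∀ i ∈ A, r i = true) ∧ (∀ i ∈ B, r i = false) then 1 else 0) =
      p ^ A.card * (1 - p) ^ B.card := by
  have key : ∀ r : Fin n → Bool,
      (if (∀ i ∈ A, r i = true) ∧ (∀ i ∈ B, r i = false) then (1 : ℝ) else 0) =
        ∏ i, ((if i ∈ A → r i = true then 1 else 0) * (if i ∈ B → r i = false then 1 else 0)) := by
    intro r
    rw [Finset.prod_mul_distrib, Finset.prod_ite_zero, Finset.prod_ite_zero]
    simp only [Finset.mem_univ, forall_true_left, Finset.prod_const_one]
    split_ifs <;> simp_all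
  simp only [key]
  rw [sum_rowProb_mul_prod p (fun i v => (if i ∈ A → v = true then (1 : ℝ) else 0) *
    (if i ∈ B → v = false then 1 else 0))]
  have : ∀ i, p * ((if i ∈ A → true = true then (1 : ℝ) else 0) *
        (if i ∈ B → true = false then 1 else 0)) +
      (1 - p) * ((if i ∈ A → false = true then (1 : ℝ) else 0) *
        (if i ∈ B → false = false then 1 else 0)) =
      (if i ∈ A then p else 1) * (if i ∈ B then 1 - p else 1) := by
    intro i
    have hd : i ∈ A → i ∉ B := fun h => Finset.disjoint_left.1 hAB h
    by_cases hA : i ∈ A <;> by_cases hB : i ∈ B <;> simp_all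
  rw [Finset.prod_congr rfl fun i _ => this i]
  simp only [Finset.prod_mul_distrib, Finset.prod_ite_mem, Finset.univ_inter, Finset.prod_const]

/-- Item `i` is the only item of `K` in the test `r`. -/
def Isolates {n : ℕ} (K : Finset (Fin n)) (i : Fin n) (r : Fin n → Bool) : Prop :=
  (∀ j ∈ ({i} : Finset (Fin n)), r j = true) ∧ ∀ j ∈ K.erase i, r j = false

open Classical in
lemma sum_rowProb_isolates {n : ℕ} (p : ℝ) (K : Finset (Fin n)) (i : Fin n) :
    ∑ r : Fin n → Bool, rowProb p r * (if Isolates K i r then 1 else 0) =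
      p * (1 - p) ^ (K.erase i).card := by
  have := sum_rowProb_ite p (A := {i}) (B := K.erase i) (by simp)
  simp only [Finset.card_singleton, pow_one] at this
  rw [← this]
  refine Finset.sum_congr rfl fun r _ => ?_
  unfold Isolates
  congr

open Classical in
/-- The average of `c` to the number of tests isolating `i`. -/
lemma sum_designProb_pow_isolates {n T : ℕ} (p c : ℝ) (K : Finset (Fin n)) (i : Fin n) :
    ∑ x : Design n T, designProb p x * ∏ t, (if Isolates K i (x t) then c else 1) =
      (1 - p * (1 - p) ^ (K.erase i).card * (1 - c)) ^ T := by
  rw [sum_designProb_mul_prod p (fun _ r => if Isolates K i r then c else 1)]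
  rw [Finset.prod_const, Finset.card_univ, Fintype.card_fin]
  congr 1
  rw [← sum_rowProb_isolates, Finset.sum_mul]
  nth_rewrite 2 [← sum_rowProb (n := n) p]
  rw [← Finset.sum_sub_distrib]
  refine Finset.sum_congr rfl fun r _ => ?_
  split_ifs <;> ring

/-! ### Decoding by linear programming succeeds whenever DD does -/

lemma mem_possibleDefectives {n T : ℕ} (K : Finset (Fin n)) (x : Design n T) {i : Fin n}
    (hi : i ∈ K) : i ∈ possibleDefectives x (outcomes K x) := by
  simp only [possibleDefectives, outcomes, Finset.mem_filter, Finset.mem_univ, true_and,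
    decide_eq_true_eq]
  exact fun t ht => ⟨i, hi, ht⟩

lemma lpFeasible_indicator {n T : ℕ} (K : Finset (Fin n)) (x : Design n T) :
    LPFeasible x (outcomes K x) (fun i => if i ∈ K then 1 else 0) := by
  refine ⟨fun i => by positivity, fun t ht => ?_, fun t ht => ?_⟩
  · simp only [outcomes, decide_eq_true_eq] at ht
    obtain ⟨i, hi, hx⟩ := ht
    have := Finset.single_le_sum (s := Finset.univ)
      (f := fun i => (if x t i = true then (1 : ℝ) else 0) * (if i ∈ K then 1 else 0))
      (fun j _ => by positivity) (Finset.mem_univ i)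
    simpa [hi, hx] using this
  · simp only [outcomes, decide_eq_false_iff_not, not_exists, not_and] at ht
    refine Finset.sum_eq_zero fun i _ => ?_
    by_cases hi : i ∈ K
    · simp [ht i hi]
    · simp [hi]

lemma LPFeasible.eq_zero {n T : ℕ} {x : Design n T} {y : Outcomes T} {z : Fin n → ℝ}
    (hz : LPFeasible x y z) {i : Fin n} (hi : i ∉ possibleDefectives x y) : z i = 0 := by
  simp only [possibleDefectives, Finset.mem_filter, Finset.mem_univ, true_and, not_forall,
    Bool.not_eq_true] at hi
  obtain ⟨t, hx, hy⟩ := hi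
  have h := hz.2.2 t hy
  rw [Finset.sum_eq_zero_iff_of_nonneg] at h
  · simpa [hx] using h i (Finset.mem_univ i)
  · intro j _
    have := hz.1 j
    positivity

/-- In the test where `i` is the only possible defective, all other variables vanish, and the
covering constraint reduces to a bound on `z i` alone. -/
lemma LPFeasible.one_le {n T : ℕ} {K : Finset (Fin n)} {x : Design n T} {z : Fin n → ℝ}
    (hz : LPFeasible x (outcomes K x) z) {i : Fin n}
    (hi : i ∈ definiteDefectives x (outcomes K x)) : 1 ≤ z i := by
  simp only [definiteDefectives, Finset.mem_filter, Finset.mem_univ, true_and] at hi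
  obtain ⟨hi, t, hx, ht⟩ := hi
  have hy : outcomes K x t = true := by
    simp only [possibleDefectives, Finset.mem_filter] at hi
    exact hi.2 t hx
  have h := hz.2.1 t hy
  rw [Finset.sum_eq_single i] at h
  · simpa [hx] using h
  · intro j _ hj
    by_cases hjx : x t j = true
    · by_cases hp : j ∈ possibleDefectives x (outcomes K x)
      · exact absurd (ht j hp hjx) hj
      · simp [hz.eq_zero hp]
    · simp [hjx]
  · simp

/-- An optimum dominates the indicator coordinatewise, while its sum is no larger because the
indicator is feasible; hence all coordinates agree. -/
lemma lpOptimal_eq_indicator {n T : ℕ} {K : Finset (Fin n)} {x : Design n T} {z : Fin n → ℝ}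
    (hK : definiteDefectives x (outcomes K x) = K) (hz : LPOptimal x (outcomes K x) z) :
    z = fun i => if i ∈ K then 1 else 0 := by
  have h1 : ∀ i, (if i ∈ K then (1 : ℝ) else 0) ≤ z i := by
    intro i
    split_ifs with hi
    · exact hz.1.one_le (hK.symm ▸ hi)
    · exact hz.1.1 i
  have h2 := hz.2 _ (lpFeasible_indicator K x)
  have h3 := le_antisymm (Finset.sum_le_sum fun i (_ : i ∈ Finset.univ) => h1 i) h2
  rw [Finset.sum_eq_sum_iff_of_le fun i _ => h1 i] at h3
  exact funext fun i => (h3 i (Finset.mem_univ i)).symm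

lemma IsLPDecoder.eq_pure {A : Decoder} (hA : IsLPDecoder A) {n T : ℕ} (k : ℕ)
    {K : Finset (Fin n)} {x : Design n T} (hK : definiteDefectives x (outcomes K x) = K) :
    A n k T x (outcomes K x) = PMF.pure (some K) := by
  obtain ⟨s, h, hs, hh, hAe⟩ := hA n k T x (outcomes K x) ⟨_, lpFeasible_indicator K x⟩
  rw [hAe]
  set z₀ : Fin n → ℝ := fun i => if i ∈ K then 1 else 0 with hz₀
  -- Uniqueness of the optimum removes all randomness from tie-breaking.
  have hsup : s.support = {z₀} := by
    refine (s.support_nonempty.subset_singleton_iff).1 fun z hz => ?_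
    exact lpOptimal_eq_indicator hK (hs z hz)
  have hsp : s = PMF.pure z₀ := by
    ext z
    by_cases hz : z = z₀
    · subst hz
      rw [(s.apply_eq_one_iff _).2 hsup]
      simp
    · rw [(s.apply_eq_zero_iff _).2 (by rw [hsup]; simpa using hz)]
      simp [hz]
  have hopt : LPOptimal x (outcomes K x) z₀ := hs z₀ (by rw [hsup]; rfl)
  rw [hsp, PMF.pure_bind, hh z₀ hopt]
  · congr 2
    ext i
    simp [hz₀]
  · intro i
    by_cases hi : i ∈ K <;> simp [hz₀, hi]

lemma one_sub_toReal_nonneg {α : Type*} (q : PMF α) (a : α) : 0 ≤ 1 - (q a).toReal :=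
  sub_nonneg.2 (ENNReal.toReal_le_of_le_ofReal zero_le_one (by simpa using q.coe_le_one a))

lemma IsLPDecoder.errorProb_le {A : Decoder} (hA : IsLPDecoder A) {p : ℝ}
    (hp : p ∈ Set.Icc (0 : ℝ) 1) (n k T : ℕ) :
    errorProb A p n k T ≤ errorProb ddDecoder p n k T := by
  unfold errorProb
  refine mul_le_mul_of_nonneg_left (Finset.sum_le_sum fun K _ => Finset.sum_le_sum fun x _ =>
    mul_le_mul_of_nonneg_left ?_ (designProb_nonneg hp x)) (by positivity)
  by_cases hK : definiteDefectives x (outcomes K x) = K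
  · rw [hA.eq_pure k hK]
    simpa using one_sub_toReal_nonneg (ddDecoder n k T x (outcomes K x)) (some K)
  · have : (ddDecoder n k T x (outcomes K x) (some K)) = 0 := by
      simp [ddDecoder, Ne.symm hK]
    rw [this]
    simp

lemma IsLPDecoder.maxRate_le {A : Decoder} (hA : IsLPDecoder A) (k : ℕ → ℕ) :
    maxRate ddDecoder k ≤ maxRate A k := by
  refine sSup_le_sSup ?_
  rintro r ⟨R, hR, rfl⟩
  refine ⟨R, fun ε hε => ?_, rfl⟩
  filter_upwards [hR ε hε] with n ⟨p, hp, T, hT, hRT, he⟩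
  exact ⟨p, hp, T, hT, hRT, (hA.errorProb_le hp n (k n) T).trans_lt he⟩

/-! ### The error probability of DD -/

/-- The possible defectives that are not defective. -/
def falsePositives {n T : ℕ} (K : Finset (Fin n)) (x : Design n T) : Finset (Fin n) :=
  possibleDefectives x (outcomes K x) \ K

lemma isolates_iff {n : ℕ} {K : Finset (Fin n)} {i : Fin n} {r : Fin n → Bool} :
    Isolates K i r ↔ r i = true ∧ ∀ j ∈ K, j ≠ i → r j = false := by
  simp only [Isolates, Finset.mem_singleton, forall_eq, Finset.mem_erase]
  exact and_congr_right fun _ => ⟨fun h j hj hne => h j ⟨hne, hj⟩, fun h j hj => h j hj.2 hj.1⟩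

/-- A nondefective `j` is cleared exactly by a test containing `j` and nothing from `K`. Phrasing
this as isolation within `insert j K` lets one probability formula serve both false positives and
masked defectives. -/
lemma mem_falsePositives {n T : ℕ} {K : Finset (Fin n)} {x : Design n T} {j : Fin n} :
    j ∈ falsePositives K x ↔ j ∉ K ∧ ∀ t, ¬ Isolates (insert j K) j (x t) := by
  simp only [falsePositives, possibleDefectives, outcomes, Finset.mem_sdiff, Finset.mem_filter,
    Finset.mem_univ, true_and, decide_eq_true_eq, isolates_iff, not_and]
  rw [and_comm]
  refine and_congr_right fun hj => forall_congr' fun t => imp_congr_right fun _ => ?_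
  push Not
  constructor
  · rintro ⟨i, hi, h⟩
    exact ⟨i, Finset.mem_insert_of_mem hi, fun h' => hj (h' ▸ hi), by simpa using h⟩
  · rintro ⟨i, hi, hne, h⟩
    exact ⟨i, (Finset.mem_insert.1 hi).resolve_left hne, by simpa using h⟩

/-- DD only errs by missing a defective item, all of whose private tests contain a false
positive. -/
lemma exists_of_definiteDefectives_ne {n T : ℕ} {K : Finset (Fin n)} {x : Design n T}
    (h : definiteDefectives x (outcomes K x) ≠ K) :
    ∃ i ∈ K, ∀ t, Isolates K i (x t) → ∃ j ∈ falsePositives K x, x t j = true := by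
  by_contra! hc
  refine h (Finset.Subset.antisymm (fun i hi => ?_) fun i hi => ?_)
  · simp only [definiteDefectives, Finset.mem_filter, Finset.mem_univ, true_and] at hi
    obtain ⟨hi, t, hx, ht⟩ := hi
    simp only [possibleDefectives, Finset.mem_filter, Finset.mem_univ, true_and] at hi
    obtain ⟨j, hj, hjx⟩ : ∃ j ∈ K, x t j = true := by simpa [outcomes] using hi t hx
    exact ht j (mem_possibleDefectives K x hj) hjx ▸ hj
  · obtain ⟨t, ht, hf⟩ := hc i hi
    rw [isolates_iff] at ht
    simp only [definiteDefectives, Finset.mem_filter, Finset.mem_univ, true_and]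
    refine ⟨mem_possibleDefectives K x hi, t, ht.1, fun j hj hjx => ?_⟩
    by_contra hne
    by_cases hjK : j ∈ K
    · simp [ht.2 j hjK hne] at hjx
    · exact hf j (Finset.mem_sdiff.2 ⟨hj, hjK⟩) hjx

open Classical in
/-- The probability that no test isolates `i`. -/
lemma sum_designProb_forall_not_isolates {n T : ℕ} (p : ℝ) (K : Finset (Fin n)) (i : Fin n) :
    ∑ x : Design n T, designProb p x * (if ∀ t, ¬ Isolates K i (x t) then 1 else 0) =
      (1 - p * (1 - p) ^ (K.erase i).card) ^ T := by
  have := sum_designProb_pow_isolates (T := T) p 0 K i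
  rw [sub_zero, mul_one] at this
  rw [← this]
  refine Finset.sum_congr rfl fun x _ => ?_
  congr 1
  rw [Finset.prod_congr rfl fun t _ => (ite_not (Isolates K i (x t)) (1 : ℝ) 0).symm,
    Finset.prod_ite_zero]
  simp

lemma sum_designProb_card_falsePositives {n T : ℕ} (p : ℝ) (K : Finset (Fin n)) :
    ∑ x : Design n T, designProb p x * ((falsePositives K x).card : ℝ) =
      (n - K.card : ℕ) * (1 - p * (1 - p) ^ K.card) ^ T := by
  classical
  have : ∀ x : Design n T, ((falsePositives K x).card : ℝ) =
      ∑ j ∈ Kᶜ, if ∀ t, ¬ Isolates (insert j K) j (x t) then 1 else 0 := by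
    intro x
    rw [Finset.sum_boole]
    congr 2
    ext j
    simp [mem_falsePositives]
  simp only [this, Finset.mul_sum]
  rw [Finset.sum_comm, Finset.sum_congr rfl (g := fun _ => (1 - p * (1 - p) ^ K.card) ^ T)]
  · simp [Finset.card_compl]
  · intro j hj
    have := sum_designProb_forall_not_isolates (T := T) p (insert j K) j
    rwa [Finset.erase_insert (Finset.mem_compl.1 hj)] at this

/-- The design `x` with the entries of nondefective items in positive tests taken from `x'`. -/
def resample {n T : ℕ} (K : Finset (Fin n)) (x x' : Design n T) : Design n T :=
  fun t i => if i ∉ K ∧ ∃ j ∈ K, x t j = true then x' t i else x t i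

lemma resample_of_mem {n T : ℕ} {K : Finset (Fin n)} (x x' : Design n T) (t : Fin T) {i : Fin n}
    (hi : i ∈ K) : resample K x x' t i = x t i := by
  simp [resample, hi]

lemma exists_resample_iff {n T : ℕ} {K : Finset (Fin n)} (x x' : Design n T) (t : Fin T) :
    (∃ j ∈ K, resample K x x' t j = true) ↔ ∃ j ∈ K, x t j = true :=
  exists_congr fun j => and_congr_right fun hj => by rw [resample_of_mem x x' t hj]

/-- Exchanging the entries of nondefective items in the positive tests of `q.1` between the two
designs. -/
def swapEntries {n T : ℕ} (K : Finset (Fin n)) (q : Design n T × Design n T) :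
    Design n T × Design n T :=
  (resample K q.1 q.2, fun t i => if i ∉ K ∧ ∃ j ∈ K, q.1 t j = true then q.1 t i else q.2 t i)

/-- Which positions are exchanged depends only on the entries of items in `K`, and those are never
moved. -/
lemma swapEntries_involutive {n T : ℕ} (K : Finset (Fin n)) :
    Function.Involutive (swapEntries (T := T) K) := by
  rintro ⟨x, x'⟩
  refine Prod.ext ?_ ?_ <;> funext t i
  · change (if i ∉ K ∧ ∃ j ∈ K, resample K x x' t j = true then _ else _) = x t i
    simp only [exists_resample_iff]
    split_ifs with h
    · simp [swapEntries, h]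
    · simp [swapEntries, resample, h]
  · change (if i ∉ K ∧ ∃ j ∈ K, resample K x x' t j = true then _ else _) = x' t i
    simp only [exists_resample_iff]
    split_ifs with h
    · simp only [swapEntries, resample, if_pos h]
    · simp only [swapEntries, if_neg h]

lemma designProb_swapEntries {n T : ℕ} (p : ℝ) (K : Finset (Fin n))
    (q : Design n T × Design n T) :
    designProb p (swapEntries K q).1 * designProb p (swapEntries K q).2 =
      designProb p q.1 * designProb p q.2 := by
  simp only [designProb, ← Finset.prod_mul_distrib]
  refine Finset.prod_congr rfl fun t _ => Finset.prod_congr rfl fun i _ => ?_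
  simp only [swapEntries, resample]
  split_ifs <;> ring

/-- Resampling the entries of nondefective items in positive tests preserves the law of the
design. -/
lemma sum_designProb_resample {n T : ℕ} (p : ℝ) (K : Finset (Fin n)) (f : Design n T → ℝ) :
    ∑ x : Design n T, designProb p x * f x =
      ∑ x : Design n T, designProb p x *
        ∑ x' : Design n T, designProb p x' * f (resample K x x') := by
  have h1 : ∑ x : Design n T, designProb p x * f x =
      ∑ q : Design n T × Design n T, designProb p q.1 * designProb p q.2 * f q.1 := by
    rw [Fintype.sum_prod_type]
    refine Finset.sum_congr rfl fun x _ => ?_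
    dsimp only
    rw [← Finset.sum_mul, ← Finset.mul_sum, sum_designProb, mul_one]
  -- After adjoining an independent copy, the swap is a measure-preserving change of variables on
  -- pairs of designs.
  rw [h1, ← Equiv.sum_comp (swapEntries_involutive K).toPerm, Fintype.sum_prod_type]
  refine Finset.sum_congr rfl fun x _ => ?_
  rw [Finset.mul_sum]
  refine Finset.sum_congr rfl fun x' _ => ?_
  rw [Function.Involutive.coe_toPerm, designProb_swapEntries, mul_assoc]
  rfl

lemma isolates_resample {n T : ℕ} {K : Finset (Fin n)} (x x' : Design n T) (t : Fin T) {i : Fin n}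
    (hi : i ∈ K) : Isolates K i (resample K x x' t) ↔ Isolates K i (x t) := by
  simp only [isolates_iff, resample_of_mem x x' t hi]
  refine and_congr_right fun _ => forall_congr' fun j => forall_congr' fun hj => ?_
  rw [resample_of_mem x x' t hj]

lemma outcomes_resample {n T : ℕ} (K : Finset (Fin n)) (x x' : Design n T) :
    outcomes K (resample K x x') = outcomes K x := by
  funext t
  simp only [outcomes, exists_resample_iff]

/-- False positivity is decided by the negative tests, whose entries are not resampled. -/
lemma falsePositives_resample {n T : ℕ} (K : Finset (Fin n)) (x x' : Design n T) :
    falsePositives K (resample K x x') = falsePositives K x := by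
  ext j
  simp only [falsePositives, possibleDefectives, outcomes_resample, Finset.mem_sdiff,
    Finset.mem_filter, Finset.mem_univ, true_and]
  refine and_congr_left fun _ => forall_congr' fun t => ?_
  by_cases h : ∃ j ∈ K, x t j = true
  · simp [outcomes, h]
  · simp [resample, h]

lemma resample_of_isolates {n T : ℕ} {K : Finset (Fin n)} {x : Design n T} (x' : Design n T)
    {t : Fin T} {i j : Fin n} (hi : i ∈ K) (h : Isolates K i (x t)) (hj : j ∉ K) :
    resample K x x' t j = x' t j :=
  if_pos ⟨hj, i, hi, (isolates_iff.1 h).1⟩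

open Classical in
/-- A union bound for the event that a test contains some item of `G`. -/
lemma sum_rowProb_exists_le {n : ℕ} {p : ℝ} (hp : p ∈ Set.Icc (0 : ℝ) 1) (G : Finset (Fin n)) :
    ∑ r : Fin n → Bool, rowProb p r * (if ∃ j ∈ G, r j = true then 1 else 0) ≤ p * G.card := by
  have h := sum_rowProb_ite p (Finset.disjoint_empty_left G)
  simp only [Finset.notMem_empty, false_imp_iff, implies_true, true_and, Finset.card_empty,
    pow_zero, one_mul] at h
  have h1 : ∑ r : Fin n → Bool, rowProb p r * (if ∃ j ∈ G, r j = true then 1 else 0) =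
      1 - (1 - p) ^ G.card := by
    rw [← h]
    rw [eq_sub_iff_add_eq, ← Finset.sum_add_distrib]
    refine Eq.trans ?_ (sum_rowProb (n := n) p)
    refine Finset.sum_congr rfl fun r _ => ?_
    by_cases hr : ∃ j ∈ G, r j = true
    · have hr' : ¬ ∀ j ∈ G, r j = false := by simpa using hr
      simp only [if_pos hr, if_neg hr']
      ring
    · have hr' : ∀ j ∈ G, r j = false := by simpa using hr
      rw [if_neg hr, if_pos hr']
      ring
  have h2 := one_add_mul_le_pow (a := -p) (by linarith [hp.2]) G.card
  rw [h1]
  rw [← sub_eq_add_neg] at h2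
  linarith

-- Given `x`, the resampled entries make the isolating tests of `i` independent, each hitting the at
-- most `g` false positives with probability at most `p * g`. The left side is thus at most the mean
-- of `(p * g) ^ N`, with `N` the number of tests isolating `i`.
open Classical in
lemma sum_designProb_masked_le {n T : ℕ} {p g : ℝ} (hp : p ∈ Set.Icc (0 : ℝ) 1)
    (hg0 : 0 ≤ g) (K : Finset (Fin n)) {i : Fin n} (hi : i ∈ K) :
    ∑ x : Design n T, designProb p x * (if ((falsePositives K x).card : ℝ) ≤ g ∧
        ∀ t, Isolates K i (x t) → ∃ j ∈ falsePositives K x, x t j = true then 1 else 0) ≤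
      (1 - p * (1 - p) ^ (K.card - 1) * (1 - p * g)) ^ T := by
  rw [← Finset.card_erase_of_mem hi, ← sum_designProb_pow_isolates, sum_designProb_resample p K]
  refine Finset.sum_le_sum fun x _ => mul_le_mul_of_nonneg_left ?_ (designProb_nonneg hp x)
  simp only [falsePositives_resample, isolates_resample _ _ _ hi]
  by_cases hg : ((falsePositives K x).card : ℝ) ≤ g
  · have key : ∀ x' : Design n T,
        (if ((falsePositives K x).card : ℝ) ≤ g ∧ ∀ t, Isolates K i (x t) →
          ∃ j ∈ falsePositives K x, resample K x x' t j = true then (1 : ℝ) else 0) =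
        ∏ t, if Isolates K i (x t) → ∃ j ∈ falsePositives K x, x' t j = true then 1 else 0 := by
      intro x'
      rw [Finset.prod_ite_zero, Finset.prod_const_one]
      have h : (((falsePositives K x).card : ℝ) ≤ g ∧ ∀ t, Isolates K i (x t) →
            ∃ j ∈ falsePositives K x, resample K x x' t j = true) ↔
          ∀ t ∈ Finset.univ, Isolates K i (x t) →
            ∃ j ∈ falsePositives K x, x' t j = true := by
        simp only [hg, true_and, Finset.mem_univ, forall_true_left]
        refine forall_congr' fun t => forall_congr' fun ht => exists_congr fun j =>
          and_congr_right fun hj => ?_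
        rw [resample_of_isolates x' hi ht (Finset.mem_sdiff.1 hj).2]
      by_cases h' : ∀ t ∈ Finset.univ, Isolates K i (x t) →
          ∃ j ∈ falsePositives K x, x' t j = true
      · rw [if_pos h', if_pos (h.2 h')]
      · rw [if_neg h', if_neg (mt h.1 h')]
    simp only [key]
    rw [sum_designProb_mul_prod p (fun t r => if Isolates K i (x t) →
      ∃ j ∈ falsePositives K x, r j = true then 1 else 0)]
    refine Finset.prod_le_prod (fun t _ => Finset.sum_nonneg fun r _ =>
      mul_nonneg (rowProb_nonneg hp r) (by positivity)) fun t _ => ?_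
    by_cases ht : Isolates K i (x t)
    · simp only [ht, forall_true_left, if_true]
      exact (sum_rowProb_exists_le hp _).trans (mul_le_mul_of_nonneg_left hg hp.1)
    · simp [ht, sum_rowProb]
  · have hpg := mul_nonneg hp.1 hg0
    have h0 : 0 ≤ ∏ t, if Isolates K i (x t) then p * g else 1 :=
      Finset.prod_nonneg fun t _ => by positivity
    simpa [hg] using h0

/-- The first term is Markov's inequality for more than `g` false positives; the second is a union
bound over the defectives whose isolating tests are all spoiled. -/
lemma sum_designProb_dd_error_le {n T : ℕ} {p g : ℝ} (hp : p ∈ Set.Icc (0 : ℝ) 1) (hg : 0 < g)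
    (k : ℕ) (K : Finset (Fin n)) :
    ∑ x : Design n T, designProb p x *
        (1 - (ddDecoder n k T x (outcomes K x) (some K)).toReal) ≤
      (n - K.card : ℕ) * (1 - p * (1 - p) ^ K.card) ^ T / g +
        K.card * (1 - p * (1 - p) ^ (K.card - 1) * (1 - p * g)) ^ T := by
  classical
  have h1 : ∀ x : Design n T, 1 - (ddDecoder n k T x (outcomes K x) (some K)).toReal ≤
      (falsePositives K x).card / g +
        ∑ i ∈ K, if ((falsePositives K x).card : ℝ) ≤ g ∧
          ∀ t, Isolates K i (x t) → ∃ j ∈ falsePositives K x, x t j = true then 1 else 0 := by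
    intro x
    have hs : 0 ≤ ∑ i ∈ K, if ((falsePositives K x).card : ℝ) ≤ g ∧
        ∀ t, Isolates K i (x t) → ∃ j ∈ falsePositives K x, x t j = true then (1 : ℝ) else 0 :=
      Finset.sum_nonneg fun i _ => by positivity
    by_cases hK : definiteDefectives x (outcomes K x) = K
    · simp only [ddDecoder, hK, PMF.pure_apply, if_true, ENNReal.toReal_one, sub_self]
      positivity
    · have hle : 1 - (ddDecoder n k T x (outcomes K x) (some K)).toReal ≤ 1 := by simp
      refine hle.trans ?_
      by_cases hc : ((falsePositives K x).card : ℝ) ≤ g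
      · obtain ⟨i, hi, h⟩ := exists_of_definiteDefectives_ne hK
        have := Finset.single_le_sum (s := K) (f := fun i =>
          if ((falsePositives K x).card : ℝ) ≤ g ∧
            ∀ t, Isolates K i (x t) → ∃ j ∈ falsePositives K x, x t j = true then (1 : ℝ) else 0)
          (fun j _ => by positivity) hi
        rw [if_pos ⟨hc, h⟩] at this
        exact this.trans (le_add_of_nonneg_left (by positivity))
      · exact ((one_le_div hg).2 (not_le.1 hc).le).trans (le_add_of_nonneg_right hs)
  refine (Finset.sum_le_sum fun x _ =>
    mul_le_mul_of_nonneg_left (h1 x) (designProb_nonneg hp x)).trans ?_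
  simp only [mul_add, Finset.sum_add_distrib, Finset.mul_sum, ← mul_div_assoc]
  rw [← Finset.sum_div, sum_designProb_card_falsePositives, Finset.sum_comm]
  refine add_le_add le_rfl ?_
  rw [← nsmul_eq_mul]
  exact Finset.sum_le_card_nsmul _ _ _ fun i hi => sum_designProb_masked_le hp hg.le K hi

/-- A bound on the error probability of DD, for any threshold `g` on the number of false
positives. -/
lemma errorProb_dd_le {p g : ℝ} (hp : p ∈ Set.Icc (0 : ℝ) 1) (hg : 0 < g) {n k : ℕ} (hk : k ≤ n)
    (T : ℕ) :
    errorProb ddDecoder p n k T ≤ (n - k : ℕ) * (1 - p * (1 - p) ^ k) ^ T / g +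
        k * (1 - p * (1 - p) ^ (k - 1) * (1 - p * g)) ^ T := by
  have hC : (0 : ℝ) < n.choose k := by exact_mod_cast Nat.choose_pos hk
  rw [errorProb, one_div, inv_mul_le_iff₀ hC, ← nsmul_eq_mul]
  have := Finset.sum_le_card_nsmul (Finset.powersetCard k (Finset.univ : Finset (Fin n)))
    (fun K => ∑ x : Design n T, designProb p x *
        (1 - (ddDecoder n k T x (outcomes K x) (some K)).toReal)) _ fun K hK => by
      have := sum_designProb_dd_error_le (T := T) hp hg k K
      rwa [(Finset.mem_powersetCard.1 hK).2] at this
  rwa [Finset.card_powersetCard, Finset.card_univ, Fintype.card_fin] at this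

/-! ### The converse: masked defective items cause errors -/

/-- Only a test isolating `i` could change its outcome when `i` is removed. -/
lemma outcomes_erase {n T : ℕ} {K : Finset (Fin n)} {x : Design n T} {i : Fin n}
    (h : ∀ t, ¬ Isolates K i (x t)) : outcomes (K.erase i) x = outcomes K x := by
  funext t
  simp only [outcomes, decide_eq_decide]
  refine ⟨fun ⟨j, hj, hx⟩ => ⟨j, Finset.mem_of_mem_erase hj, hx⟩, fun ⟨j, hj, hx⟩ => ?_⟩
  by_cases hji : j = i
  · subst hji
    have := h t
    simp only [Isolates, Finset.mem_singleton, forall_eq, hx, true_and] at this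
    push Not at this
    simpa using this
  · exact ⟨j, Finset.mem_erase.2 ⟨hji, hj⟩, hx⟩

lemma sum_toReal_le_one {α : Type*} (q : PMF α) (s : Finset α) :
    ∑ a ∈ s, (q a).toReal ≤ 1 := by
  rw [← ENNReal.toReal_sum fun a _ => q.apply_ne_top a]
  refine ENNReal.toReal_le_of_le_ofReal zero_le_one ?_
  rw [ENNReal.ofReal_one, ← q.tsum_coe]
  exact ENNReal.sum_le_tsum s

/-- On a family of defective sets, a decoder succeeds at most once for every outcome. -/
lemma sum_success_le_card_image {n T : ℕ} (A : Decoder) (k : ℕ) (x : Design n T)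
    (S : Finset (Finset (Fin n))) :
    ∑ K ∈ S, (A n k T x (outcomes K x) (some K)).toReal ≤
      ((S.image fun K => outcomes K x).card : ℝ) := by
  rw [← Finset.sum_fiberwise_of_maps_to (t := S.image fun K => outcomes K x)
    (g := fun K => outcomes K x) fun K hK => Finset.mem_image_of_mem _ hK, Finset.cast_card]
  refine Finset.sum_le_sum fun y _ => ?_
  rw [Finset.sum_congr rfl (g := fun K => (A n k T x y (some K)).toReal)
    fun K hK => by rw [(Finset.mem_filter.1 hK).2]]
  have := sum_toReal_le_one (A n k T x y)
    ((S.filter fun K => outcomes K x = y).map Function.Embedding.some)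
  rwa [Finset.sum_map] at this

open Classical in
lemma sum_success_le {n T : ℕ} (A : Decoder) (k : ℕ) (x : Design n T) :
    ∑ K ∈ Finset.powersetCard k (Finset.univ : Finset (Fin n)),
        (A n k T x (outcomes K x) (some K)).toReal ≤
      ∑ K ∈ Finset.powersetCard k (Finset.univ : Finset (Fin n)),
        (if ∀ i ∈ K, ∃ t, Isolates K i (x t) then 1 else 0) + (n.choose (k - 1) : ℝ) := by
  rw [← Finset.sum_filter_add_sum_filter_not _ fun K => ∀ i ∈ K, ∃ t, Isolates K i (x t)]
  refine add_le_add ?_ ?_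
  · rw [← Finset.sum_filter]
    refine Finset.sum_le_sum fun K _ => ?_
    linarith [one_sub_toReal_nonneg (A n k T x (outcomes K x)) (some K)]
  -- Outcomes are counted instead of sets: each remaining `K` has a masked item, so its outcomes
  -- already arise from a set of size `k - 1`.
  · refine (sum_success_le_card_image A k x _).trans ?_
    norm_cast
    calc _ ≤ ((Finset.powersetCard (k - 1) (Finset.univ : Finset (Fin n))).image
            fun K => outcomes K x).card := by
          refine Finset.card_le_card fun y hy => ?_
          obtain ⟨K, hK, rfl⟩ := Finset.mem_image.1 hy
          obtain ⟨hK, hm⟩ := Finset.mem_filter.1 hK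
          push Not at hm
          obtain ⟨i, hi, hm⟩ := hm
          refine Finset.mem_image.2 ⟨K.erase i, ?_, outcomes_erase hm⟩
          rw [Finset.mem_powersetCard, Finset.card_erase_of_mem hi,
            (Finset.mem_powersetCard.1 hK).2]
          exact ⟨Finset.subset_univ _, rfl⟩
      _ ≤ _ := Finset.card_image_le
      _ = n.choose (k - 1) := by
          rw [Finset.card_powersetCard, Finset.card_univ, Fintype.card_fin]

open Classical in
/-- The probability that neither of two items is isolated in any test. -/
lemma sum_designProb_pair {n T : ℕ} (p : ℝ) {K : Finset (Fin n)} {i j : Fin n} (hi : i ∈ K)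
    (hj : j ∈ K) (hij : i ≠ j) :
    ∑ x : Design n T, designProb p x * ((if ∀ t, ¬ Isolates K i (x t) then 1 else 0) *
        (if ∀ t, ¬ Isolates K j (x t) then 1 else 0)) =
      (1 - 2 * (p * (1 - p) ^ (K.card - 1))) ^ T := by
  have h1 : ∀ r : Fin n → Bool, (if ¬ Isolates K i r ∧ ¬ Isolates K j r then (1 : ℝ) else 0) =
      1 - (if Isolates K i r then 1 else 0) - (if Isolates K j r then 1 else 0) := by
    intro r
    have : ¬ (Isolates K i r ∧ Isolates K j r) := fun h => by
      have h1 := h.1.1 i (Finset.mem_singleton_self i)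
      have h2 := h.2.2 i (Finset.mem_erase.2 ⟨hij, hi⟩)
      simp [h1] at h2
    by_cases h1 : Isolates K i r <;> by_cases h2 : Isolates K j r <;> simp_all
  have h2 : ∑ r : Fin n → Bool, rowProb p r *
      (if ¬ Isolates K i r ∧ ¬ Isolates K j r then (1 : ℝ) else 0) =
      1 - 2 * (p * (1 - p) ^ (K.card - 1)) := by
    simp only [h1, mul_sub, Finset.sum_sub_distrib, sum_rowProb_isolates, mul_one, sum_rowProb,
      Finset.card_erase_of_mem hi, Finset.card_erase_of_mem hj]
    ring
  have h3 := sum_designProb_mul_prod (T := T) p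
    (fun _ r => if ¬ Isolates K i r ∧ ¬ Isolates K j r then (1 : ℝ) else 0)
  rw [h2, Finset.prod_const, Finset.card_univ, Fintype.card_fin] at h3
  rw [← h3]
  refine Finset.sum_congr rfl fun x _ => ?_
  congr 1
  rw [Finset.prod_ite_zero, Finset.prod_const_one]
  simp only [Finset.mem_univ, forall_true_left, forall_and]
  by_cases h1 : ∀ t, ¬ Isolates K i (x t) <;> by_cases h2 : ∀ t, ¬ Isolates K j (x t) <;>
    simp [h1, h2]

/-- This keeps the bases `1 - a` and `1 - 2 * a` of the masking probabilities positive; for `k = 1`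
and `p = 1` it would fail. -/
lemma mul_pow_pred_le {p : ℝ} (hp : p ∈ Set.Icc (0 : ℝ) 1) {k : ℕ} (hk : 2 ≤ k) :
    p * (1 - p) ^ (k - 1) ≤ 1 / 4 := by
  have h0 : 0 ≤ 1 - p := by linarith [hp.2]
  have : (1 - p) ^ (k - 1) ≤ 1 - p :=
    pow_le_of_le_one h0 (by linarith [hp.1]) (by omega)
  nlinarith [mul_le_mul_of_nonneg_left this hp.1, sq_nonneg (p - 1 / 2)]

open Classical in
/-- Chebyshev's inequality for the number of masked defective items. -/
lemma sum_designProb_forall_isolated_mul_le {n : ℕ} {p : ℝ} (hp : p ∈ Set.Icc (0 : ℝ) 1)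
    {K : Finset (Fin n)} (hK : 2 ≤ K.card) (T : ℕ) :
    (∑ x : Design n T, designProb p x * (if ∀ i ∈ K, ∃ t, Isolates K i (x t) then 1 else 0)) *
      (K.card * (1 - p * (1 - p) ^ (K.card - 1)) ^ T) ≤ 1 := by
  set a := p * (1 - p) ^ (K.card - 1) with ha
  have ha4 : a ≤ 1 / 4 := mul_pow_pred_le hp hK
  set m := (1 - a) ^ T with hm
  have hm0 : 0 < m := pow_pos (by linarith) T
  set μ : ℝ := K.card * m with hμ
  have hμ0 : 0 < μ := mul_pos (by exact_mod_cast (by omega : 0 < K.card)) hm0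
  let I : Fin n → Design n T → ℝ := fun i x => if ∀ t, ¬ Isolates K i (x t) then 1 else 0
  let X : Design n T → ℝ := fun x => ∑ i ∈ K, I i x
  have hI : ∀ i ∈ K, ∑ x : Design n T, designProb p x * I i x = m := fun i hi => by
    rw [hm, ha, ← Finset.card_erase_of_mem hi]
    exact sum_designProb_forall_not_isolates p K i
  have h1 : ∑ x : Design n T, designProb p x * X x = μ := by
    simp only [X, Finset.mul_sum]
    rw [Finset.sum_comm, Finset.sum_congr rfl hI, Finset.sum_const, nsmul_eq_mul]
  have hpair : ∀ i ∈ K, ∀ j ∈ K, ∑ x : Design n T, designProb p x * (I i x * I j x) ≤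
      (if i = j then m else 0) + m ^ 2 := by
    intro i hi j hj
    split_ifs with hij
    · subst hij
      have : ∀ x, I i x * I i x = I i x := fun x => by simp [I]
      simp only [this, hI i hi]
      nlinarith
    · have := sum_designProb_pair (T := T) p hi hj hij
      rw [← ha] at this
      rw [zero_add]
      refine this.le.trans ?_
      -- Masking events are negatively correlated: `1 - 2 * a ≤ (1 - a) ^ 2`. So the variance is at
      -- most the mean.
      rw [hm, ← pow_mul, mul_comm T 2, pow_mul]
      exact pow_le_pow_left₀ (by linarith) (by nlinarith [sq_nonneg a]) T
  have h2 : ∑ x : Design n T, designProb p x * X x ^ 2 ≤ μ + μ ^ 2 := by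
    have : ∀ x, designProb p x * X x ^ 2 = ∑ i ∈ K, ∑ j ∈ K, designProb p x * (I i x * I j x) := by
      intro x
      simp only [X]
      rw [sq, Finset.sum_mul_sum]
      simp only [Finset.mul_sum]
    simp only [this]
    rw [Finset.sum_comm]
    refine (Finset.sum_le_sum fun i hi => (Finset.sum_comm.le.trans
      (Finset.sum_le_sum fun j hj => hpair i hi j hj))).trans (le_of_eq ?_)
    rw [Finset.sum_congr rfl (g := fun _ => m + K.card * m ^ 2)]
    · rw [Finset.sum_const, nsmul_eq_mul, hμ]
      ring
    · intro i hi
      rw [Finset.sum_add_distrib, Finset.sum_ite_eq, if_pos hi, Finset.sum_const, nsmul_eq_mul]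
  have h3 : ∑ x : Design n T, designProb p x * (X x - μ) ^ 2 ≤ μ := by
    have : ∀ x, designProb p x * (X x - μ) ^ 2 = designProb p x * X x ^ 2 -
        2 * μ * (designProb p x * X x) + μ ^ 2 * designProb p x := fun x => by ring
    simp only [this]
    rw [Finset.sum_add_distrib, Finset.sum_sub_distrib, ← Finset.mul_sum, ← Finset.mul_sum, h1,
      sum_designProb]
    nlinarith
  have h4 : (∑ x : Design n T, designProb p x *
      (if ∀ i ∈ K, ∃ t, Isolates K i (x t) then 1 else 0)) * μ ^ 2 ≤ μ := by
    refine le_trans ?_ h3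
    rw [Finset.sum_mul]
    refine Finset.sum_le_sum fun x _ => ?_
    rw [mul_assoc]
    refine mul_le_mul_of_nonneg_left ?_ (designProb_nonneg hp x)
    split_ifs with h
    -- With no masked item, the squared deviation from the mean is exactly `μ ^ 2`.
    · have : X x = 0 := Finset.sum_eq_zero fun i hi => if_neg (by simpa using h i hi)
      rw [this]
      nlinarith
    · rw [zero_mul]
      positivity
  rw [sq, ← mul_assoc] at h4
  exact le_of_mul_le_mul_right (h4.trans (one_mul μ).ge) hμ0

/-- Any decoder errs, unless all defective items are isolated in some test. -/
lemma le_errorProb (A : Decoder) {p : ℝ} (hp : p ∈ Set.Icc (0 : ℝ) 1) {n k : ℕ} (hk : 2 ≤ k)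
    (hkn : k ≤ n) (T : ℕ) :
    1 - 1 / (k * (1 - p * (1 - p) ^ (k - 1)) ^ T) - k / (n - k + 1) ≤ errorProb A p n k T := by
  classical
  set m := (1 - p * (1 - p) ^ (k - 1)) ^ T with hm
  have hm0 : 0 < m := pow_pos (by linarith [mul_pow_pred_le hp hk]) T
  have hk0 : (0 : ℝ) < k := by exact_mod_cast (by omega : 0 < k)
  have hC : (0 : ℝ) < n.choose k := by exact_mod_cast Nat.choose_pos hkn
  set P := Finset.powersetCard k (Finset.univ : Finset (Fin n)) with hP
  have hPc : (P.card : ℝ) = n.choose k := by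
    rw [hP, Finset.card_powersetCard, Finset.card_univ, Fintype.card_fin]
  have hchoose : (n.choose (k - 1) : ℝ) = n.choose k * (k / (n - k + 1)) := by
    obtain ⟨l, rfl⟩ : ∃ l, k = l + 1 := ⟨k - 1, by omega⟩
    have h := Nat.choose_succ_right_eq n l
    have h' : (n.choose (l + 1) : ℝ) * (l + 1) = n.choose l * (n - l) := by
      rw [← Nat.cast_sub (by omega)]
      exact_mod_cast h
    have hl : (0 : ℝ) < n - l := by
      rw [sub_pos]
      exact_mod_cast hkn
    have he : (n : ℝ) - (l + 1 : ℕ) + 1 = n - l := by push_cast; ring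
    rw [he, Nat.add_sub_cancel, ← mul_div_assoc, eq_div_iff hl.ne', ← h']
    push_cast
    ring
  have hsum : ∑ K ∈ P, ∑ x : Design n T,
      designProb p x * (1 - (A n k T x (outcomes K x) (some K)).toReal) =
      n.choose k - ∑ x : Design n T, designProb p x *
        ∑ K ∈ P, (A n k T x (outcomes K x) (some K)).toReal := by
    simp only [mul_sub, mul_one, Finset.sum_sub_distrib, sum_designProb, Finset.sum_const,
      nsmul_eq_mul, hPc, Finset.mul_sum]
    rw [Finset.sum_comm]
  have hbound : ∑ x : Design n T, designProb p x *
        ∑ K ∈ P, (A n k T x (outcomes K x) (some K)).toReal ≤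
      n.choose k * (1 / (k * m)) + n.choose (k - 1) := by
    refine (Finset.sum_le_sum fun x _ => mul_le_mul_of_nonneg_left (sum_success_le A k x)
      (designProb_nonneg hp x)).trans ?_
    simp only [mul_add, Finset.sum_add_distrib, Finset.mul_sum]
    rw [← Finset.sum_mul, sum_designProb, one_mul, Finset.sum_comm, ← hPc, ← nsmul_eq_mul]
    gcongr
    refine Finset.sum_le_card_nsmul _ _ _ fun K hK => ?_
    have hKc := (Finset.mem_powersetCard.1 hK).2
    have := sum_designProb_forall_isolated_mul_le hp (hKc.symm ▸ hk) T
    rw [hKc] at this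
    rwa [le_div_iff₀ (by positivity)]
  rw [errorProb, hsum, one_div_mul_eq_div, le_div_iff₀ hC]
  rw [hchoose] at hbound
  linarith

/-! ### Asymptotics -/

section Sparse

variable {θ : ℝ} {k : ℕ → ℕ}

lemma tendsto_log_natCast_atTop : Tendsto (fun n : ℕ => Real.log n) atTop atTop :=
  Real.tendsto_log_atTop.comp tendsto_natCast_atTop_atTop

lemma tendsto_sparse_atTop (hθ0 : 0 < θ)
    (hk : (fun n : ℕ => (k n : ℝ)) =Θ[atTop] (fun n : ℕ => (n : ℝ) ^ θ)) :
    Tendsto k atTop atTop := by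
  have h1 : Tendsto (fun n : ℕ => (n : ℝ) ^ θ) atTop atTop :=
    (tendsto_rpow_atTop hθ0).comp tendsto_natCast_atTop_atTop
  have h2 := hk.tendsto_norm_atTop_iff.2 (tendsto_norm_atTop_atTop.comp h1)
  have h3 : Tendsto (fun n : ℕ => (k n : ℝ)) atTop atTop := by
    refine h2.congr fun n => ?_
    simp
  exact tendsto_natCast_atTop_iff.1 h3

lemma tendsto_sparse_div (hθ1 : θ < 1)
    (hk : (fun n : ℕ => (k n : ℝ)) =Θ[atTop] (fun n : ℕ => (n : ℝ) ^ θ)) :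
    Tendsto (fun n : ℕ => (k n : ℝ) / n) atTop (𝓝 0) := by
  have h : (fun n : ℕ => (n : ℝ) ^ θ) =o[atTop] fun n : ℕ => (n : ℝ) := by
    rw [isLittleO_iff_tendsto' (by
      filter_upwards [eventually_gt_atTop 0] with n hn h0
      exact absurd h0 (by exact_mod_cast hn.ne'))]
    refine ((tendsto_rpow_neg_atTop (sub_pos.2 hθ1)).comp tendsto_natCast_atTop_atTop).congr' ?_
    filter_upwards [eventually_gt_atTop 0] with n hn
    rw [Function.comp_apply, neg_sub, Real.rpow_sub_one (by exact_mod_cast hn.ne')]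
  exact (hk.1.trans_isLittleO h).tendsto_div_nhds_zero

lemma tendsto_log_sparse_div (hθ0 : 0 < θ)
    (hk : (fun n : ℕ => (k n : ℝ)) =Θ[atTop] (fun n : ℕ => (n : ℝ) ^ θ)) :
    Tendsto (fun n : ℕ => Real.log (k n) / Real.log n) atTop (𝓝 θ) := by
  obtain ⟨c₁, hc₁, h₁⟩ := hk.1.exists_pos
  obtain ⟨c₂, hc₂, h₂⟩ := hk.2.exists_pos
  have hlog := tendsto_log_natCast_atTop
  have hl : ∀ c : ℝ, Tendsto (fun n : ℕ => θ + c / Real.log n) atTop (𝓝 θ) := fun c => by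
    simpa using (hlog.const_div_atTop c).const_add θ
  have hk1 := (tendsto_sparse_atTop hθ0 hk).eventually_ge_atTop 1
  refine tendsto_of_tendsto_of_tendsto_of_le_of_le' (hl (-Real.log c₂)) (hl (Real.log c₁)) ?_ ?_
  · filter_upwards [h₂.bound, hk1, hlog.eventually_gt_atTop 0, eventually_gt_atTop 0]
      with n hb hkn hln hn
    have hn' : (0 : ℝ) < n := by exact_mod_cast hn
    have hk' : (0 : ℝ) < k n := by exact_mod_cast hkn
    rw [Real.norm_of_nonneg (by positivity), Real.norm_of_nonneg (by positivity)] at hb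
    have := Real.log_le_log (by positivity) hb
    rw [Real.log_rpow hn', Real.log_mul hc₂.ne' hk'.ne'] at this
    rw [le_div_iff₀ hln, add_mul, div_mul_cancel₀ _ hln.ne']
    linarith
  · filter_upwards [h₁.bound, hk1, hlog.eventually_gt_atTop 0, eventually_gt_atTop 0]
      with n hb hkn hln hn
    have hn' : (0 : ℝ) < n := by exact_mod_cast hn
    have hk' : (0 : ℝ) < k n := by exact_mod_cast hkn
    rw [Real.norm_of_nonneg (by positivity), Real.norm_of_nonneg (by positivity)] at hb
    have := Real.log_le_log (by positivity) hb
    rw [Real.log_mul hc₁.ne' (by positivity), Real.log_rpow hn'] at this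
    rw [div_le_iff₀ hln, add_mul, div_mul_cancel₀ _ hln.ne']
    linarith

lemma log_choose_le {n k : ℕ} (hk : 0 < k) (hkn : k ≤ n) :
    Real.log (n.choose k) ≤ k * (Real.log n - Real.log k + 1) := by
  have hk' : (0 : ℝ) < k := by exact_mod_cast hk
  have hn' : (0 : ℝ) < n := by exact_mod_cast hk.trans_le hkn
  have hC : (0 : ℝ) < n.choose k := by exact_mod_cast Nat.choose_pos hkn
  have h1 : (n.choose k : ℝ) ≤ n ^ k / k.factorial := Nat.choose_le_pow_div k n
  have h2 := Real.pow_div_factorial_le_exp k hk'.le k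
  have h3 : (n.choose k : ℝ) * k ^ k ≤ n ^ k * Real.exp k := by
    calc (n.choose k : ℝ) * k ^ k ≤ n ^ k / k.factorial * k ^ k := by gcongr
      _ = n ^ k * (k ^ k / k.factorial) := by ring
      _ ≤ n ^ k * Real.exp k := by gcongr
  have h4 := Real.log_le_log (by positivity) h3
  rw [Real.log_mul hC.ne' (by positivity), Real.log_mul (by positivity) (by positivity),
    Real.log_exp, Real.log_pow, Real.log_pow] at h4
  linarith

lemma le_log_choose {n k : ℕ} (hk : 0 < k) (hkn : 2 * k ≤ n) :
    k * (Real.log n - Real.log 2 - Real.log k) ≤ Real.log (n.choose k) := by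
  have hk' : (0 : ℝ) < k := by exact_mod_cast hk
  have hn' : (0 : ℝ) < n := by exact_mod_cast (by omega : 0 < n)
  have hC : (0 : ℝ) < n.choose k := by exact_mod_cast Nat.choose_pos (by omega)
  have h1 : ((n + 1 - k : ℕ) ^ k : ℝ) / k.factorial ≤ n.choose k := Nat.pow_le_choose k n
  have h2 : (k.factorial : ℝ) ≤ k ^ k := by exact_mod_cast Nat.factorial_le_pow k
  have h3 : (n / 2 : ℝ) ≤ (n + 1 - k : ℕ) := by
    rw [Nat.cast_sub (by omega)]
    have : (2 * k : ℝ) ≤ n := by exact_mod_cast hkn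
    push_cast
    linarith
  have h4 : (n / 2 : ℝ) ^ k ≤ n.choose k * k ^ k := by
    rw [div_le_iff₀ (by positivity)] at h1
    calc (n / 2 : ℝ) ^ k ≤ (n + 1 - k : ℕ) ^ k := by gcongr
      _ ≤ _ := h1
      _ ≤ _ := by gcongr
  have h5 := Real.log_le_log (by positivity) h4
  rw [Real.log_mul hC.ne' (by positivity), Real.log_pow, Real.log_pow,
    Real.log_div hn'.ne' two_ne_zero] at h5
  linarith

lemma tendsto_log_choose_div (hθ0 : 0 < θ) (hθ1 : θ < 1)
    (hk : (fun n : ℕ => (k n : ℝ)) =Θ[atTop] (fun n : ℕ => (n : ℝ) ^ θ)) :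
    Tendsto (fun n : ℕ => Real.log (n.choose (k n)) / (k n * Real.log n)) atTop (𝓝 (1 - θ)) := by
  have hlog := tendsto_log_natCast_atTop
  have hl : ∀ c : ℝ, Tendsto (fun n : ℕ => 1 - Real.log (k n) / Real.log n + c / Real.log n)
      atTop (𝓝 (1 - θ)) := fun c => by
    simpa using ((tendsto_log_sparse_div hθ0 hk).const_sub 1).add (hlog.const_div_atTop c)
  have hk1 := (tendsto_sparse_atTop hθ0 hk).eventually_ge_atTop 1
  have hk2 := (tendsto_sparse_div hθ1 hk).eventually_lt_const (by norm_num : (0 : ℝ) < 1 / 2)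
  have hkn : ∀ᶠ n : ℕ in atTop, 2 * k n ≤ n := by
    filter_upwards [hk2, eventually_gt_atTop 0] with n h hn
    rw [div_lt_iff₀ (by exact_mod_cast hn)] at h
    have : (2 * k n : ℝ) ≤ n := by linarith
    exact_mod_cast this
  refine tendsto_of_tendsto_of_tendsto_of_le_of_le' (hl (-Real.log 2)) (hl 1) ?_ ?_
  · filter_upwards [hk1, hkn, hlog.eventually_gt_atTop 0] with n h1 h2 h3
    have hk' : (0 : ℝ) < k n := by exact_mod_cast h1
    rw [le_div_iff₀ (by positivity)]
    refine le_trans (le_of_eq ?_) (le_log_choose h1 h2)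
    field_simp
    ring
  · filter_upwards [hk1, hkn, hlog.eventually_gt_atTop 0] with n h1 h2 h3
    have hk' : (0 : ℝ) < k n := by exact_mod_cast h1
    rw [div_le_iff₀ (by positivity)]
    refine (log_choose_le h1 (by omega)).trans (le_of_eq ?_)
    field_simp

lemma tendsto_one_sub_inv_pow (hk : Tendsto k atTop atTop) :
    Tendsto (fun n : ℕ => (1 - 1 / (k n : ℝ)) ^ k n) atTop (𝓝 (Real.exp (-1))) := by
  have := (Real.tendsto_one_add_div_pow_exp (-1)).comp hk
  refine this.congr fun n => ?_
  simp [sub_eq_add_neg, neg_div]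

/-- All error terms are written as exponentials, so only their exponents on the scale `log n`
matter. -/
lemma tendsto_exp_of_div_log {f : ℕ → ℝ} {c : ℝ} (hc : c < 0)
    (hf : Tendsto (fun n : ℕ => f n / Real.log n) atTop (𝓝 c)) :
    Tendsto (fun n => Real.exp (f n)) atTop (𝓝 0) := by
  refine Real.tendsto_exp_atBot.comp ((hf.neg_mul_atTop hc tendsto_log_natCast_atTop).congr' ?_)
  filter_upwards [tendsto_log_natCast_atTop.eventually_gt_atTop 0] with n hn
  exact div_mul_cancel₀ _ hn.ne'

end Sparse

/-! ### The capacity formula and the two rate thresholds -/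

/-- The second term of the minimum peaks at `ν = 1`, since `ν e^{-ν} ≤ e^{-1}`. There the entropy is
no obstacle: in nats it is at least `e^{-1}`, and `(1 - θ)/θ ≤ 1`. -/
lemma capacityFormula_eq {θ : ℝ} (hθ : 1 / 2 ≤ θ) (hθ1 : θ < 1) :
    capacityFormula θ = 1 / (Real.exp 1 * Real.log 2) * ((1 - θ) / θ) := by
  have hθ0 : 0 < θ := by linarith
  have hr0 : 0 ≤ (1 - θ) / θ := div_nonneg (by linarith) hθ0.le
  have hr1 : (1 - θ) / θ ≤ 1 := (div_le_one hθ0).2 (by linarith)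
  have hl2 : 0 < Real.log 2 := Real.log_pos one_lt_two
  refine IsGreatest.csSup_eq ⟨⟨1, Set.mem_Ioi.2 one_pos, ?_⟩, ?_⟩
  · refine min_eq_right ?_
    have hent : Real.exp (-1) ≤ Real.binEntropy (Real.exp (-1)) := by
      rw [Real.binEntropy, Real.log_inv, Real.log_exp, neg_neg, mul_one]
      refine le_add_of_nonneg_right (mul_nonneg ?_ (Real.log_nonneg ?_))
      · simp
      · exact (one_le_inv₀ (by simp)).2 (by linarith [Real.exp_pos (-1)])
    calc 1 / (Real.exp 1 * Real.log 2) * ((1 - θ) / θ) ≤ 1 / (Real.exp 1 * Real.log 2) * 1 := by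
          gcongr
      _ = Real.exp (-1) / Real.log 2 := by
          rw [Real.exp_neg, mul_one, one_div, mul_inv, div_eq_mul_inv]
      _ ≤ _ := by gcongr
  · rintro _ ⟨ν, hν, rfl⟩
    refine (min_le_right _ _).trans (mul_le_mul_of_nonneg_right ?_ hr0)
    rw [div_le_div_iff₀ (by positivity) (by positivity)]
    have h1 := Real.add_one_le_exp (ν - 1)
    rw [Real.exp_sub, sub_add_cancel, le_div_iff₀ (Real.exp_pos 1)] at h1
    nlinarith

variable {θ : ℝ} {k : ℕ → ℕ}

/-- A sufficient number of tests for DD to succeed with the parameter `1 / k`. -/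
lemma tendsto_errorProb_dd (hθ0 : 0 < θ)
    (hk : (fun n : ℕ => (k n : ℝ)) =Θ[atTop] (fun n : ℕ => (n : ℝ) ^ θ)) (hθ1 : θ < 1)
    {T : ℕ → ℕ} {τ : ℝ}
    (hT : Tendsto (fun n : ℕ => (T n : ℝ) / (k n * Real.log n)) atTop (𝓝 τ))
    (h1 : 1 - θ < τ * Real.exp (-1)) (h2 : θ < τ * Real.exp (-1)) {ε : ℝ} (hε : 0 < ε) :
    ∀ᶠ n : ℕ in atTop, errorProb ddDecoder (1 / (k n : ℝ)) n (k n) (T n) < ε := by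
  obtain ⟨η, hη0, hη1, hη⟩ : ∃ η : ℝ, 0 < η ∧ η < 1 ∧ θ < τ * Real.exp (-1) * (1 - η) := by
    set b := τ * Real.exp (-1) with hb
    -- This choice makes `b * (1 - η)` the midpoint of `θ` and `b`.
    refine ⟨(1 - θ / b) / 2, ?_, ?_, ?_⟩
    · have : θ / b < 1 := (div_lt_one (hθ0.trans h2)).2 h2
      linarith
    · have : 0 < θ / b := div_pos hθ0 (hθ0.trans h2)
      linarith
    · have : b * (θ / b) = θ := mul_div_cancel₀ _ (hθ0.trans h2).ne'
      nlinarith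
  have hkt := tendsto_sparse_atTop hθ0 hk
  have hlog := tendsto_log_natCast_atTop
  set Q : ℕ → ℝ := fun n => (1 - 1 / (k n : ℝ)) ^ k n with hQ
  have hQt : Tendsto Q atTop (𝓝 (Real.exp (-1))) := tendsto_one_sub_inv_pow hkt
  have hu := hT.mul hQt
  have e1 : Tendsto (fun n : ℕ => Real.exp (Real.log n - Real.log (k n) - T n / k n * Q n))
      atTop (𝓝 0) := by
    refine tendsto_exp_of_div_log (c := 1 - θ - τ * Real.exp (-1)) (by linarith) ?_
    refine (((tendsto_log_sparse_div hθ0 hk).const_sub 1).sub hu).congr' ?_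
    filter_upwards [hlog.eventually_gt_atTop 0, hkt.eventually_gt_atTop 0] with n hn hkn
    have : (0 : ℝ) < k n := by exact_mod_cast hkn
    field_simp
  have e2 : Tendsto (fun n : ℕ => Real.exp (Real.log (k n) - T n / k n * Q n * (1 - η)))
      atTop (𝓝 0) := by
    refine tendsto_exp_of_div_log (c := θ - τ * Real.exp (-1) * (1 - η)) (by linarith) ?_
    refine ((tendsto_log_sparse_div hθ0 hk).sub (hu.mul_const (1 - η))).congr' ?_
    filter_upwards [hlog.eventually_gt_atTop 0, hkt.eventually_gt_atTop 0] with n hn hkn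
    have : (0 : ℝ) < k n := by exact_mod_cast hkn
    field_simp
  have e3 : Tendsto (fun n : ℕ => Real.exp (Real.log n - Real.log (k n) - T n / k n * Q n) / η +
      Real.exp (Real.log (k n) - T n / k n * Q n * (1 - η))) atTop (𝓝 0) := by
    simpa using (e1.div_const η).add e2
  have hkn := (tendsto_sparse_div hθ1 hk).eventually_lt_const one_pos
  filter_upwards [e3.eventually_lt_const hε, hkt.eventually_gt_atTop 0, hkn,
    eventually_gt_atTop 0] with n hn hk0 hkn hn0
  have hk0' : (0 : ℝ) < k n := by exact_mod_cast hk0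
  have hn0' : (0 : ℝ) < n := by exact_mod_cast hn0
  have hkn' : k n ≤ n := by
    rw [div_lt_one hn0'] at hkn
    exact_mod_cast hkn.le
  have hk1 : (1 : ℝ) ≤ k n := by exact_mod_cast hk0
  have hp : 1 / (k n : ℝ) ∈ Set.Icc (0 : ℝ) 1 := ⟨by positivity, (div_le_one hk0').2 hk1⟩
  have hq0 : 0 ≤ 1 - 1 / (k n : ℝ) := sub_nonneg.2 hp.2
  have hQ0 : 0 ≤ Q n := pow_nonneg hq0 _
  have hQle : Q n ≤ (1 - 1 / (k n : ℝ)) ^ (k n - 1) :=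
    pow_le_pow_of_le_one hq0 (by linarith [hp.1]) (Nat.sub_le _ _)
  have hq1 : (1 - 1 / (k n : ℝ)) ^ (k n - 1) ≤ 1 := pow_le_one₀ hq0 (by linarith [hp.1])
  have hpow : ∀ s : ℝ, s ≤ 1 → (1 - s) ^ T n ≤ Real.exp (-(T n * s)) := fun s hs => by
    refine (pow_le_pow_left₀ (by linarith) (Real.one_sub_le_exp_neg s) (T n)).trans ?_
    rw [← Real.exp_nat_mul, mul_neg]
  -- With threshold `g = η k` and `p = 1/k`, the spoiling probability `p * g` is the constant `η`.
  refine (errorProb_dd_le hp (mul_pos hη0 hk0') hkn' (T n)).trans_lt (lt_of_le_of_lt ?_ hn)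
  rw [show 1 / (k n : ℝ) * (η * k n) = η by field_simp]
  refine add_le_add ?_ ?_
  · have hle : ((n - k n : ℕ) : ℝ) ≤ n := by exact_mod_cast Nat.sub_le _ _
    have := hpow (1 / (k n : ℝ) * Q n) (mul_le_one₀ hp.2 hQ0 (hQle.trans hq1))
    calc _ ≤ n * Real.exp (-(T n * (1 / (k n : ℝ) * Q n))) / (η * k n) := by
          have h0 : 0 ≤ 1 - 1 / (k n : ℝ) * Q n :=
            sub_nonneg.2 (mul_le_one₀ hp.2 hQ0 (hQle.trans hq1))
          gcongr
      _ = _ := by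
          rw [sub_eq_add_neg, Real.exp_add, Real.exp_sub, Real.exp_log hn0', Real.exp_log hk0']
          field_simp
  · have h1η : 0 ≤ 1 - η := by linarith
    have hs : 1 / (k n : ℝ) * (1 - 1 / (k n : ℝ)) ^ (k n - 1) * (1 - η) ≤ 1 :=
      mul_le_one₀ (mul_le_one₀ hp.2 (pow_nonneg hq0 _) hq1) h1η (by linarith)
    have := hpow _ hs
    calc _ ≤ k n * Real.exp (-(T n * (1 / (k n : ℝ) * Q n * (1 - η)))) := by
          refine mul_le_mul_of_nonneg_left (this.trans (Real.exp_le_exp.2 ?_)) hk0'.le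
          refine neg_le_neg ?_
          gcongr
      _ = _ := by
          rw [sub_eq_add_neg (Real.log (k n)), Real.exp_add, Real.exp_log hk0']
          congr 2
          ring

/-- The rates below `min {1 / (e ln 2), (1 - θ) / (e θ ln 2)}` are achievable by DD. -/
lemma achievable_dd (hθ0 : 0 < θ) (hθ1 : θ < 1)
    (hk : (fun n : ℕ => (k n : ℝ)) =Θ[atTop] (fun n : ℕ => (n : ℝ) ^ θ)) {R : ℝ}
    (hR : R < min (1 / (Real.exp 1 * Real.log 2))
        (1 / (Real.exp 1 * Real.log 2) * ((1 - θ) / θ))) :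
    Achievable ddDecoder k R := by
  have hl2 : 0 < Real.log 2 := Real.log_pos one_lt_two
  have h1θ : 0 < 1 - θ := by linarith
  have hB : 0 < min (1 / (Real.exp 1 * Real.log 2))
      (1 / (Real.exp 1 * Real.log 2) * ((1 - θ) / θ)) := lt_min (by positivity) (by positivity)
  -- `R` may be negative or zero, so a positive rate `S` above it is used to define the number of
  -- tests; rounding down then keeps the rate at least `S`.
  obtain ⟨S, hS, hSB⟩ := exists_between (max_lt hR hB)
  obtain ⟨hRS, hS0⟩ := max_lt_iff.1 hS
  obtain ⟨hS1, hS2⟩ := lt_min_iff.1 hSB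
  intro ε hε
  set τ : ℝ := (1 - θ) / (Real.log 2 * S) with hτ
  set x : ℕ → ℝ := fun n => Real.log (n.choose (k n)) / (Real.log 2 * S) with hx
  have hkt := tendsto_sparse_atTop hθ0 hk
  have hlog := tendsto_log_natCast_atTop
  have hkl : Tendsto (fun n : ℕ => (k n : ℝ) * Real.log n) atTop atTop :=
    (tendsto_natCast_atTop_atTop.comp hkt).atTop_mul_atTop₀ hlog
  have hxt : Tendsto (fun n : ℕ => x n / (k n * Real.log n)) atTop (𝓝 τ) := by
    refine ((tendsto_log_choose_div hθ0 hθ1 hk).div_const (Real.log 2 * S)).congr fun n => ?_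
    rw [hx, div_right_comm]
  have hT : Tendsto (fun n : ℕ => (⌊x n⌋₊ : ℝ) / (k n * Real.log n)) atTop (𝓝 τ) := by
    have hlow : Tendsto (fun n : ℕ => x n / (k n * Real.log n) - 1 / (k n * Real.log n))
        atTop (𝓝 τ) := by
      simpa using hxt.sub (hkl.const_div_atTop 1)
    have hx0 : ∀ n, 0 ≤ x n := fun n => div_nonneg (Real.log_natCast_nonneg _) (by positivity)
    refine tendsto_of_tendsto_of_tendsto_of_le_of_le' hlow hxt ?_ ?_
    · filter_upwards [hkl.eventually_gt_atTop 0] with n hn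
      rw [← sub_div]
      gcongr
      linarith [Nat.lt_floor_add_one (x n)]
    · filter_upwards [hkl.eventually_gt_atTop 0] with n hn
      gcongr
      exact Nat.floor_le (hx0 n)
  have hτ0 : 0 < τ := by positivity
  have hτ1 : 1 - θ < τ * Real.exp (-1) := by
    rw [lt_div_iff₀ (by positivity)] at hS1
    rw [hτ, Real.exp_neg, ← div_eq_mul_inv, div_div, lt_div_iff₀ (by positivity)]
    nlinarith
  have hτ2 : θ < τ * Real.exp (-1) := by
    rw [div_mul_div_comm, one_mul, lt_div_iff₀ (by positivity)] at hS2
    rw [hτ, Real.exp_neg, ← div_eq_mul_inv, div_div, lt_div_iff₀ (by positivity)]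
    nlinarith
  filter_upwards [tendsto_errorProb_dd hθ0 hk hθ1 hT hτ1 hτ2 hε, hT.eventually_const_lt hτ0,
    hkl.eventually_gt_atTop 0, hkt.eventually_gt_atTop 0] with n he hTn hkln hkn
  have hTpos : 0 < ⌊x n⌋₊ := by
    have := (div_pos_iff_of_pos_right hkln).1 hTn
    exact_mod_cast this
  have hk1 : (1 : ℝ) ≤ k n := by exact_mod_cast hkn
  refine ⟨1 / (k n : ℝ), ⟨by positivity, (div_le_one (by linarith)).2 hk1⟩, ⌊x n⌋₊, hTpos,
    hRS.trans_le ?_, he⟩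
  have hTpos' : (0 : ℝ) < ⌊x n⌋₊ := by exact_mod_cast hTpos
  rw [le_div_iff₀ hTpos', Real.logb, le_div_iff₀ hl2]
  have := Nat.floor_le (show 0 ≤ x n from div_nonneg (Real.log_natCast_nonneg _) (by positivity))
  rw [hx, le_div_iff₀ (by positivity)] at this
  linarith

/-- A bound on the probability that a test isolates a given defective item. -/
lemma mul_pow_le_inv {p : ℝ} (hp : p ∈ Set.Icc (0 : ℝ) 1) {l : ℕ} (hl : 0 < l) :
    p * (1 - p) ^ l ≤ 1 / (Real.exp 1 * l) := by
  have hl' : (0 : ℝ) < l := by exact_mod_cast hl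
  have h1 : (1 - p) ^ l ≤ Real.exp (-(l * p)) := by
    refine (pow_le_pow_left₀ (by linarith [hp.2]) (Real.one_sub_le_exp_neg p) l).trans ?_
    rw [← Real.exp_nat_mul, mul_neg]
  have h2 := Real.add_one_le_exp (l * p - 1)
  rw [sub_add_cancel, Real.exp_sub, le_div_iff₀ (Real.exp_pos 1)] at h2
  rw [le_div_iff₀ (by positivity)]
  calc p * (1 - p) ^ l * (Real.exp 1 * l) = l * p * Real.exp 1 * (1 - p) ^ l := by ring
    _ ≤ Real.exp (l * p) * Real.exp (-(l * p)) := by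
      have : 0 ≤ (1 - p) ^ l := pow_nonneg (by linarith [hp.2]) l
      gcongr
    _ = 1 := by rw [← Real.exp_add, add_neg_cancel, Real.exp_zero]

/-- Since `1 + 1/b ≤ e^{1/b}`, one has `1 - 1/(b + 1) = b/(b + 1) ≥ e^{-1/b}`; writing the bound on
`a` with `b + 1` avoids any second-order error. -/
lemma exp_neg_le_pow {a b x : ℝ} (hab : a ≤ 1 / (b + 1)) (hb : 0 < b) {T : ℕ} (hT : (T : ℝ) ≤ x) :
    Real.exp (-(x / b)) ≤ (1 - a) ^ T := by
  have h1 : b / (b + 1) ≤ 1 - a := by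
    have : b / (b + 1) = 1 - 1 / (b + 1) := by field_simp; ring
    linarith
  have h2 : Real.exp (-(1 / b)) ≤ b / (b + 1) := by
    rw [Real.exp_neg, inv_le_comm₀ (Real.exp_pos _) (by positivity), inv_div, add_div,
      div_self hb.ne', add_comm]
    exact Real.add_one_le_exp _
  calc Real.exp (-(x / b)) ≤ Real.exp (-(T / b)) := by gcongr
    _ = Real.exp (-(1 / b)) ^ T := by
      rw [← Real.exp_nat_mul]
      congr 1
      ring
    _ ≤ _ := pow_le_pow_left₀ (Real.exp_pos _).le (h2.trans h1) T

/-- No decoder achieves a rate above `(1 - θ) / (e θ ln 2)`. -/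
lemma not_achievable (hθ0 : 0 < θ) (hθ1 : θ < 1)
    (hk : (fun n : ℕ => (k n : ℝ)) =Θ[atTop] (fun n : ℕ => (n : ℝ) ^ θ)) {A : Decoder} {R : ℝ}
    (hR : 1 / (Real.exp 1 * Real.log 2) * ((1 - θ) / θ) < R) : ¬ Achievable A k R := by
  intro hA
  have hl2 : 0 < Real.log 2 := Real.log_pos one_lt_two
  have h1θ : 0 < 1 - θ := by linarith
  have hR0 : 0 < R := lt_trans (by positivity) hR
  have hkt := tendsto_sparse_atTop hθ0 hk
  have hlog := tendsto_log_natCast_atTop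
  have hkt' : Tendsto (fun n => (k n : ℝ)) atTop atTop := tendsto_natCast_atTop_atTop.comp hkt
  set x : ℕ → ℝ := fun n => Real.log (n.choose (k n)) / (Real.log 2 * R) with hx
  -- Chosen so that `b n + 1 = e (k n - 1)`, the denominator in `mul_pow_le_inv` with `l = k n - 1`.
  set b : ℕ → ℝ := fun n => Real.exp 1 * (k n - 1) - 1 with hb
  have hbk : Tendsto (fun n => b n / k n) atTop (𝓝 (Real.exp 1)) := by
    have : Tendsto (fun n => Real.exp 1 - (Real.exp 1 + 1) / k n) atTop (𝓝 (Real.exp 1)) := by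
      simpa using (hkt'.const_div_atTop (Real.exp 1 + 1)).const_sub (Real.exp 1)
    refine this.congr' ?_
    filter_upwards [hkt'.eventually_gt_atTop 0] with n hn
    rw [hb]
    field_simp
    ring
  have e1 : Tendsto (fun n : ℕ => Real.exp (x n / b n - Real.log (k n))) atTop (𝓝 0) := by
    refine tendsto_exp_of_div_log (c := (1 - θ) / (Real.log 2 * R) / Real.exp 1 - θ) ?_ ?_
    · rw [div_mul_div_comm, one_mul, div_lt_iff₀ (by positivity)] at hR
      rw [sub_neg, div_div, div_lt_iff₀ (by positivity)]
      nlinarith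
    · refine (((((tendsto_log_choose_div hθ0 hθ1 hk).div_const (Real.log 2 * R)).div hbk
        (Real.exp_pos 1).ne')).sub (tendsto_log_sparse_div hθ0 hk)).congr' ?_
      filter_upwards [hlog.eventually_gt_atTop 0, hkt'.eventually_gt_atTop 0,
        hbk.eventually_const_lt (Real.exp_pos 1)] with n hn hkn hbn
      have hb0 : 0 < b n := (div_pos_iff_of_pos_right hkn).1 hbn
      rw [Pi.div_apply]
      simp only [hx]
      field_simp
  have e2 : Tendsto (fun n : ℕ => (k n : ℝ) / (n - k n + 1)) atTop (𝓝 0) := by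
    have hkn := tendsto_sparse_div hθ1 hk
    have : Tendsto (fun n : ℕ => (k n / n : ℝ) / (1 - k n / n + 1 / n)) atTop (𝓝 0) := by
      have hd := (hkn.const_sub 1).add
        ((tendsto_natCast_atTop_atTop (R := ℝ)).const_div_atTop 1)
      simpa [Pi.div_def] using hkn.div hd (by norm_num)
    refine this.congr' ?_
    filter_upwards [eventually_gt_atTop 0] with n hn
    have hn' : (0 : ℝ) < n := by exact_mod_cast hn
    rw [div_div, mul_add, mul_sub, mul_one, mul_div_cancel₀ _ hn'.ne', mul_div_cancel₀ _ hn'.ne']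
  have e3 := e1.add e2
  rw [add_zero] at e3
  -- A single large `n` suffices: achievability gives error below `1/2`, while the two vanishing
  -- losses force it above `1/2`.
  obtain ⟨n, ⟨p, hp, T, hT, hRT, he⟩, hlt, hk2, hbn, hkn, hn0⟩ := ((hA (1 / 2) (by norm_num)).and
    ((e3.eventually_lt_const (by norm_num : (0 : ℝ) < 1 / 2)).and
    ((hkt.eventually_ge_atTop 2).and ((hbk.eventually_const_lt (Real.exp_pos 1)).and
    (((tendsto_sparse_div hθ1 hk).eventually_lt_const one_pos).and
      (eventually_gt_atTop 0)))))).exists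
  have hk0 : (0 : ℝ) < k n := by exact_mod_cast (by omega : 0 < k n)
  have hb0 : 0 < b n := (div_pos_iff_of_pos_right hk0).1 hbn
  have hkn' : k n ≤ n := by
    rw [div_lt_one (by exact_mod_cast hn0)] at hkn
    exact_mod_cast hkn.le
  have hT0 : (0 : ℝ) < T := by exact_mod_cast hT
  have hTx : (T : ℝ) ≤ x n := by
    rw [lt_div_iff₀ hT0, Real.logb, lt_div_iff₀ hl2] at hRT
    rw [hx, le_div_iff₀ (by positivity)]
    linarith
  have ha : p * (1 - p) ^ (k n - 1) ≤ 1 / (b n + 1) := by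
    refine (mul_pow_le_inv hp (by omega)).trans (le_of_eq ?_)
    rw [hb, Nat.cast_sub (by omega)]
    simp
  have hm := exp_neg_le_pow ha hb0 hTx
  have hle : 1 / (k n * (1 - p * (1 - p) ^ (k n - 1)) ^ T) ≤
      Real.exp (x n / b n - Real.log (k n)) := by
    calc _ ≤ 1 / (k n * Real.exp (-(x n / b n))) := by gcongr
      _ = _ := by
        rw [Real.exp_sub, Real.exp_log hk0, Real.exp_neg]
        field_simp
  have := le_errorProb A hp hk2 hkn' T
  linarith

lemma maxRate_le_of_not_achievable {A : Decoder} {c : ℝ}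
    (h : ∀ R : ℝ, c < R → ¬ Achievable A k R) : maxRate A k ≤ (c : EReal) := by
  refine sSup_le ?_
  rintro _ ⟨R, hR, rfl⟩
  exact EReal.coe_le_coe_iff.2 (not_lt.1 fun hc => h R hc hR)

lemma le_maxRate_of_achievable {A : Decoder} {c : ℝ}
    (h : ∀ R : ℝ, R < c → Achievable A k R) : (c : EReal) ≤ maxRate A k := by
  by_contra! hc
  obtain ⟨R, hR, hRc⟩ := EReal.lt_iff_exists_real_btwn.1 hc
  exact hR.not_ge (le_sSup ⟨R, h R (EReal.coe_lt_coe_iff.1 hRc), rfl⟩)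

end GroupTesting

theorem theorem3 (θ : ℝ) (hθ0 : 0 < θ) (hθ1 : θ < 1)
    (k : ℕ → ℕ) (hk : (fun n : ℕ => (k n : ℝ)) =Θ[atTop] (fun n : ℕ => (n : ℝ) ^ θ))
    (A : GroupTesting.Decoder) (hA : GroupTesting.IsLPDecoder A) :
    GroupTesting.maxRate GroupTesting.ddDecoder k ≤ GroupTesting.maxRate A k ∧
    ((min (1 / (Real.exp 1 * Real.log 2))
        (1 / (Real.exp 1 * Real.log 2) * ((1 - θ) / θ)) : ℝ) : EReal) ≤
      GroupTesting.maxRate GroupTesting.ddDecoder k ∧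
    (1 / 2 ≤ θ →
      GroupTesting.maxRate A k = GroupTesting.capacity k ∧
      GroupTesting.maxRate A k = ((GroupTesting.capacityFormula θ : ℝ) : EReal)) := by
  have hLP := hA.maxRate_le k
  have hDD := GroupTesting.le_maxRate_of_achievable (A := GroupTesting.ddDecoder) (k := k)
    fun R => GroupTesting.achievable_dd hθ0 hθ1 hk
  refine ⟨hLP, hDD, fun hθ => ?_⟩
  have hcap : GroupTesting.capacity k ≤ ((GroupTesting.capacityFormula θ : ℝ) : EReal) := by
    rw [GroupTesting.capacityFormula_eq hθ hθ1]
    exact iSup_le fun B => GroupTesting.maxRate_le_of_not_achievable fun R =>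
      GroupTesting.not_achievable hθ0 hθ1 hk
  have hform : ((GroupTesting.capacityFormula θ : ℝ) : EReal) ≤ GroupTesting.maxRate A k := by
    have hl2 : 0 < Real.log 2 := Real.log_pos one_lt_two
    -- For `θ ≥ 1/2` the factor `(1 - θ)/θ` is at most `1`, so the DD bound coincides with the
    -- converse.
    rw [min_eq_right (mul_le_of_le_one_right (by positivity)
      ((div_le_one hθ0).2 (by linarith))), ← GroupTesting.capacityFormula_eq hθ hθ1] at hDD
    exact hDD.trans hLP
  have hle : GroupTesting.maxRate A k ≤ GroupTesting.capacity k :=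
    le_iSup (fun B => GroupTesting.maxRate B k) A
  exact ⟨hle.antisymm (hcap.trans hform), (hle.trans hcap).antisymm hform⟩
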